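/- Let $G$ be a finite, simple, connected graph with vertex set $V$ and edge set $E$, $|E|\ge 2$. Let $B\subseteq V$ (possibly empty) be such that $V^\circ := V\setminus B$ is nonempty and induces a connected subgraph, and fix $\gamma\in\{-1,1\}^B$. For $J=(J_e)_{e\in E}\in\mathbb{R}^E$ let $$H_J(\sigma) := -\sum_{\{i,j\}\in E} J_{ij}\sigma_i\sigma_j,\qquad \sigma\in\{-1,1\}^V,$$ and call $\sigma$ a ground state in the environment $J$ if it minimizes $H_J$ among all configurations in $\{-1,1\}^V$ that agree with $\gamma$ on $B$ (no constraint if $B=\emptyset$). Let $p\in(0,1)$. Let $J=(J_e)_{e\in E}$ and $J'=(J'_e)_{e\in E}$ be independent families of i.i.d. standard Gaussian random variables, and let $J^{(p)}$ be obtained from $J$ by a perturbation of either of the following two kinds: (1) $J^{(p)}_e=(1-p)J_e+\sqrt{2p-p^2}\,J'_e$ for every $e\in E$; (2) each $J_e$ is replaced by $J'_e$ with probability $p$, independently for the different edges and independently of $J$ and $J'$. Let $\sigma$ and $\sigma'$ be ground states in the environments $J$ and $J^{(p)}$, respectively. Then for all $i,j\in V^\circ$, $$|\mathbb{E}(\sigma_i\sigma_j\sigma'_i\sigma'_j)|\le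 (1-p)^{\min\{d(i,j),\,d(i,B)+d(j,B)\}},$$ where $d$ is the graph distance on $G$ and $d(i,B):=\min\{d(i,k):k\in B\}$ (infinity if $B=\emptyset$). Here $\sigma$ and $\sigma'$ may be any choices (on the underlying probability space) of random configurations that are almost surely ground states in the respective environments (if $B=\emptyset$, ground states are determined only up to sign); for all such choices, $\sigma_i\sigma_j\sigma'_i\sigma'_j$ is integrable, so the expectation is well-defined. -/

import Mathlib

open MeasureTheory ProbabilityTheory

namespace EdwardsAnderson

noncomputable section

/-- The real number `σ_i σ_j` attached to an unordered pair `{i, j}`; the spin space `{-1, 1}` is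
the type `ℤˣ`. -/
def bondSpin {V : Type*} (σ : V → ℤˣ) (e : Sym2 V) : ℝ :=
  Sym2.lift ⟨fun i j => ((σ i * σ j : ℤˣ) : ℝ), fun i j => by simp only [mul_comm]⟩ e

/-- The Edwards-Anderson Hamiltonian `H_J(σ) = - ∑_{{i,j} ∈ E} J_{ij} σ_i σ_j`. -/
def hamiltonian {V : Type*} (G : SimpleGraph V) [Fintype G.edgeSet] (J : G.edgeSet → ℝ)
    (σ : V → ℤˣ) : ℝ :=
  -∑ e : G.edgeSet, J e * bondSpin σ (e : Sym2 V)

/-- The configuration `σ` equals `γ` on `B`; there is no constraint if `B` is empty. -/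
def SatisfiesBoundary {V : Type*} {B : Set V} (γ : B → ℤˣ) (σ : V → ℤˣ) : Prop :=
  ∀ k : B, σ k = γ k

/-- `σ` minimizes `H_J` among all configurations that equal `γ` on `B`. The case `B = ∅` is the
free boundary condition. -/
def IsGroundState {V : Type*} (G : SimpleGraph V) [Fintype G.edgeSet] {B : Set V} (γ : B → ℤˣ)
    (J : G.edgeSet → ℝ) (σ : V → ℤˣ) : Prop :=
  SatisfiesBoundary γ σ ∧
    ∀ τ : V → ℤˣ, SatisfiesBoundary γ τ → hamiltonian G J σ ≤ hamiltonian G J τ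

/-- The law of a family of i.i.d. standard Gaussian random variables indexed by `E`. -/
def gaussianDisorder (E : Type*) [Fintype E] : Measure (E → ℝ) :=
  Measure.pi fun _ => gaussianReal 0 1

/-- The law of a family of i.i.d. Bernoulli variables indexed by `E`, each `true` with
probability `p`. -/
def bernoulliSelection (E : Type*) [Fintype E] (p : unitInterval) : Measure (E → Bool) :=
  Measure.pi fun _ => bernoulliMeasure true false p

/-- First kind of perturbation of the standard Gaussian environment `J`: each `J_e` is replaced by
`(1 - p) J_e + √(2p - p²) J'_e`, with `J'` an independent standard Gaussian environment. -/
def IsGaussianPerturbation {Ω E : Type*} [MeasurableSpace Ω] [Fintype E] (P : Measure Ω)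
    (p : unitInterval) (J Jp : Ω → E → ℝ) : Prop :=
  HasLaw J (gaussianDisorder E) P ∧
  ∃ J' : Ω → E → ℝ, HasLaw J' (gaussianDisorder E) P ∧ IndepFun J J' P ∧
    ∀ ω e, Jp ω e = (1 - (p : ℝ)) * J ω e + √(2 * (p : ℝ) - (p : ℝ) ^ 2) * J' ω e

/-- Second kind of perturbation of the standard Gaussian environment `J`: each `J_e` is replaced by
`J'_e` with probability `p`, independently for the different edges. The replacements are made where
`ξ_e = true`, and `J`, `J'`, `ξ` are mutually independent. -/
def IsResamplingPerturbation {Ω E : Type*} [MeasurableSpace Ω] [Fintype E] (P : Measure Ω)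
    (p : unitInterval) (J Jp : Ω → E → ℝ) : Prop :=
  HasLaw J (gaussianDisorder E) P ∧
  ∃ (J' : Ω → E → ℝ) (ξ : Ω → E → Bool), HasLaw J' (gaussianDisorder E) P ∧
    HasLaw ξ (bernoulliSelection E p) P ∧
    IndepFun J (fun ω => (J' ω, ξ ω)) P ∧ IndepFun J' ξ P ∧
    ∀ ω e, Jp ω e = if ξ ω e = true then J' ω e else J ω e

/-- The graph distance `d(i, B) = min {d(i, k) : k ∈ B}`, infinite if `B` is empty. -/
def distToSet {V : Type*} (G : SimpleGraph V) (i : V) (B : Set V) : ℕ∞ :=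
  ⨅ k ∈ B, G.edist i k

/-- `min {d(i, j), d(i, B) + d(j, B)}`, as an extended natural number. -/
def chaosExponent {V : Type*} (G : SimpleGraph V) (B : Set V) (i j : V) : ℕ∞ :=
  min (G.edist i j) (distToSet G i B + distToSet G j B)

/-- The exponent is finite in a connected graph, so that `ENat.toNat` loses nothing. -/
theorem chaosExponent_ne_top {V : Type*} {G : SimpleGraph V} (hG : G.Connected) (B : Set V)
    (i j : V) : chaosExponent G B i j ≠ ⊤ := by
  have h : G.edist i j ≠ ⊤ := SimpleGraph.edist_ne_top_iff_reachable.mpr (hG.preconnected i j)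
  exact ne_top_of_le_ne_top h (min_le_left _ _)

end

end EdwardsAnderson

namespace EdwardsAnderson

noncomputable section

/-! Let `φ(J)` be the value of `σ_i σ_j` in a ground state (`overlap`). The expectation is the noise
correlation `E[φ(J) φ(J⁽ᵖ⁾)]`, and the pairs `(J_e, J⁽ᵖ⁾_e)` are i.i.d. with correlation `ρ = 1 -
p`.

Write `m` for the exponent. Flipping the spins on a set disjoint from `B` that contains exactly one
of `i`, `j` flips the couplings across its edge boundary and changes the sign of `φ`. Fewer than `m`
edges can neither join `i` to `j` nor join both to `B`, so some such set has a boundary avoiding any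
given `S` with `|S| < m` (`exists_sign_overlap_odd`). In spectral terms, `φ` has no component
depending on fewer than `m` edges, so noise should contract its correlation by `ρ ^ m`.

No eigenfunction expansion is used. Let `g(t)` be the noise correlation at parameter `t`. A crude
bound `|g(t)| ≤ C t ^ m` follows by splitting the pair law into a part symmetric in the second
variable, where oddness cancels, and a part of mass `O(t)` (`abs_noiseCorr_le`). Cauchy-Schwarz and
the semigroup property give `g(t)² ≤ g(t²)` (`noiseCorr_sq_le`). Iterating this removes the constant
`C` (`abs_le_pow_of_sq_le`). Both perturbations fit this scheme. Almost sure uniqueness of `σ_i σ_j`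
(`ae_notMem_overlapSet_inter`) makes the choice of ground states irrelevant. -/

/-- The correlation `E[φ(X) φ(Y)]`, where the pairs `(X_e, Y_e)` are i.i.d. with law `κ`. -/
def noiseCorr {E : Type*} [Fintype E] (κ : Measure (ℝ × ℝ)) (φ : (E → ℝ) → ℝ) : ℝ :=
  ∫ z : E → ℝ × ℝ, φ (fun e => (z e).1) * φ (fun e => (z e).2) ∂Measure.pi fun _ => κ

/-! ### Integrals of functions bounded by one -/

section Bounded

variable {α : Type*} [MeasurableSpace α] {μ : Measure α}

theorem integrable_of_abs_le_one [IsFiniteMeasure μ] {f : α → ℝ} (hf : AEMeasurable f μ)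
    (hb : ∀ x, |f x| ≤ 1) : Integrable f μ :=
  Integrable.of_bound hf.aestronglyMeasurable 1 (Filter.Eventually.of_forall hb)

theorem abs_mul_le_one {a b : ℝ} (ha : |a| ≤ 1) (hb : |b| ≤ 1) : |a * b| ≤ 1 := by
  rw [abs_mul]
  exact mul_le_one₀ ha (abs_nonneg _) hb

theorem abs_integral_le_one [IsProbabilityMeasure μ] {f : α → ℝ} (hb : ∀ x, |f x| ≤ 1) :
    |∫ x, f x ∂μ| ≤ 1 := by
  simpa using norm_integral_le_of_norm_le_const (μ := μ) (f := f) (C := 1)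
    (Filter.Eventually.of_forall hb)

theorem sq_integral_le_integral_sq [IsProbabilityMeasure μ] {f : α → ℝ} (hf : Measurable f)
    (hb : ∀ x, |f x| ≤ 1) : (∫ x, f x ∂μ) ^ 2 ≤ ∫ x, f x ^ 2 ∂μ := by
  have h := variance_nonneg f μ
  rw [variance_eq_sub (MemLp.of_bound hf.aestronglyMeasurable 1 (Filter.Eventually.of_forall hb))]
    at h
  simpa using h

end Bounded

/-! ### Cauchy-Schwarz along the noise semigroup -/

section Semigroup

variable {E : Type*} [Fintype E] {N : Type*} [MeasurableSpace N]
  {μ : Measure ℝ} [IsProbabilityMeasure μ] {ν : Measure N} [IsProbabilityMeasure ν]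

theorem noiseCorr_map_prod {F₁ F₂ : ℝ × N → ℝ} (hF₁ : Measurable F₁) (hF₂ : Measurable F₂)
    {φ : (E → ℝ) → ℝ} (hφ : Measurable φ) (hb : ∀ x, |φ x| ≤ 1) :
    noiseCorr ((μ.prod ν).map fun w => (F₁ w, F₂ w)) φ =
      ∫ x : E → ℝ, ∫ n : E → N, φ (fun e => F₁ (x e, n e)) * φ (fun e => F₂ (x e, n e))
        ∂(Measure.pi fun _ => ν) ∂(Measure.pi fun _ => μ) := by
  have hm : Measurable fun w => (F₁ w, F₂ w) := hF₁.prodMk hF₂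
  have : IsProbabilityMeasure ((μ.prod ν).map fun w => (F₁ w, F₂ w)) :=
    Measure.isProbabilityMeasure_map hm.aemeasurable
  rw [noiseCorr, ← Measure.pi_map_pi (fun _ : E => hm.aemeasurable), integral_map,
    ← integral_prod (fun w : (E → ℝ) × (E → N) =>
      φ (fun e => F₁ (w.1 e, w.2 e)) * φ (fun e => F₂ (w.1 e, w.2 e))),
    ← (measurePreserving_arrowProdEquivProdArrow ℝ N E (fun _ => μ) (fun _ => ν)).integral_comp']
  · rfl
  · refine integrable_of_abs_le_one (Measurable.aemeasurable ?_)
      fun x => abs_mul_le_one (hb _) (hb _)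
    fun_prop
  · fun_prop
  · refine Measurable.aestronglyMeasurable ?_
    fun_prop

/-- With `h(x)` the mean of `φ` after noise started at `x`, the left side is `(∫ φ h)²`, at most `∫
h²` as `|φ| ≤ 1`. Squaring `h` amounts to using two independent noises from the same `x`, which is
the right side. -/
theorem noiseCorr_sq_le {F : ℝ × N → ℝ} (hF : Measurable F)
    {φ : (E → ℝ) → ℝ} (hφ : Measurable φ) (hb : ∀ x, |φ x| ≤ 1) :
    noiseCorr ((μ.prod ν).map fun w => (w.1, F w)) φ ^ 2 ≤
      noiseCorr ((μ.prod (ν.prod ν)).map fun w => (F (w.1, w.2.1), F (w.1, w.2.2))) φ := by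
  set h : (E → ℝ) → ℝ := fun x => ∫ n : E → N, φ (fun e => F (x e, n e)) ∂(Measure.pi fun _ => ν)
    with h_def
  have hm : Measurable h := by
    refine (StronglyMeasurable.integral_prod_right' (f := fun w : (E → ℝ) × (E → N) =>
      φ (fun e => F (w.1 e, w.2 e))) (Measurable.stronglyMeasurable ?_)).measurable
    fun_prop
  have hh : ∀ x, |h x| ≤ 1 := fun x => abs_integral_le_one fun _ => hb _
  have e₁ : noiseCorr ((μ.prod ν).map fun w => (w.1, F w)) φ =
      ∫ x : E → ℝ, φ x * h x ∂(Measure.pi fun _ => μ) := by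
    rw [noiseCorr_map_prod measurable_fst hF hφ hb]
    simp only [integral_const_mul, h_def]
  have e₂ : noiseCorr ((μ.prod (ν.prod ν)).map fun w => (F (w.1, w.2.1), F (w.1, w.2.2))) φ =
      ∫ x : E → ℝ, h x ^ 2 ∂(Measure.pi fun _ => μ) := by
    rw [noiseCorr_map_prod (F₁ := fun w : ℝ × N × N => F (w.1, w.2.1))
      (F₂ := fun w : ℝ × N × N => F (w.1, w.2.2))
      (by fun_prop) (by fun_prop) hφ hb]
    congr 1 with x
    rw [sq, h_def, ← integral_prod_mul,
      ← (measurePreserving_arrowProdEquivProdArrow N N E (fun _ => ν) (fun _ => ν)).integral_comp']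
    rfl
  rw [e₁, e₂]
  refine (sq_integral_le_integral_sq (hφ.mul hm) fun x => abs_mul_le_one (hb x) (hh x)).trans ?_
  refine integral_mono (integrable_of_abs_le_one (by fun_prop) fun x => ?_)
    (integrable_of_abs_le_one (by fun_prop) fun x => ?_) fun x => ?_
  · rw [abs_pow]
    exact pow_le_one₀ (abs_nonneg _) (abs_mul_le_one (hb x) (hh x))
  · rw [abs_pow]
    exact pow_le_one₀ (abs_nonneg _) (hh x)
  · rw [Pi.mul_apply, mul_pow]
    exact mul_le_of_le_one_left (sq_nonneg _) ((sq_le_one_iff_abs_le_one _).2 (hb x))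

end Semigroup

/-- Power trick: iterating `hsq` gives `|g ρ| ^ 2 ^ n ≤ C * (ρ ^ m) ^ 2 ^ n` for all `n`, so a ratio
`|g ρ| / ρ ^ m` above one would have bounded powers. -/
theorem abs_le_pow_of_sq_le {g : ℝ → ℝ} {ρ C : ℝ} {m : ℕ} (h₀ : 0 < ρ) (h₁ : ρ < 1)
    (hsq : ∀ t, 0 < t → t < 1 → g t ^ 2 ≤ g (t ^ 2))
    (hC : ∀ t, 0 < t → t ≤ ρ → |g t| ≤ C * t ^ m) : |g ρ| ≤ ρ ^ m := by
  have hpow : ∀ n : ℕ, |g ρ| ^ 2 ^ n ≤ |g (ρ ^ 2 ^ n)| := by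
    intro n
    induction n with
    | zero => simp
    | succ n ih =>
      calc |g ρ| ^ 2 ^ (n + 1) = (|g ρ| ^ 2 ^ n) ^ 2 := by rw [← pow_mul, pow_succ]
        _ ≤ |g (ρ ^ 2 ^ n)| ^ 2 := by gcongr
        _ = g (ρ ^ 2 ^ n) ^ 2 := sq_abs _
        _ ≤ g ((ρ ^ 2 ^ n) ^ 2) := hsq _ (by positivity) (pow_lt_one₀ h₀.le h₁ (by positivity))
        _ ≤ |g (ρ ^ 2 ^ (n + 1))| := by
          rw [← pow_mul, ← pow_succ]
          exact le_abs_self _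
  by_contra! hlt
  have hr : 1 < |g ρ| / ρ ^ m := (one_lt_div (by positivity)).2 hlt
  obtain ⟨n, hn⟩ := pow_unbounded_of_one_lt C hr
  have hle : (|g ρ| / ρ ^ m) ^ 2 ^ n ≤ C := by
    rw [div_pow, div_le_iff₀ (by positivity), pow_right_comm]
    exact (hpow n).trans (hC _ (by positivity) (pow_le_of_le_one h₀.le h₁.le (by positivity)))
  exact absurd (hn.trans_le ((pow_le_pow_right₀ hr.le n.lt_two_pow_self.le).trans hle)) (lt_irrefl _)

/-! ### Crude bound from a nearly symmetric pair law -/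

section Decomposition

variable {E : Type*} [Fintype E]

-- Expand the product of the laws `s + η` over the set `S` of coordinates that use `η`. If `|S| <
-- m`, the sign flip `ε` acts on the second variable only at coordinates of law `s`, so it preserves
-- the measure while negating the integrand: the term vanishes. Any other term is at most the mass
-- `δ ^ |S|`.
open Classical in
theorem abs_noiseCorr_le {κ s η : Measure (ℝ × ℝ)} [IsProbabilityMeasure κ] (h : κ = s + η)
    (hs : s.map (fun z => (z.1, -z.2)) = s) {δ : ℝ} (hδ : 0 ≤ δ)
    (hη : η Set.univ ≤ ENNReal.ofReal δ)
    {φ : (E → ℝ) → ℝ} (hφ : Measurable φ) (hb : ∀ x, |φ x| ≤ 1) {m : ℕ}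
    (hodd : ∀ S : Finset E, S.card < m → ∃ ε : E → ℝ, (∀ e, ε e = 1 ∨ ε e = -1) ∧
      (∀ e ∈ S, ε e = 1) ∧ ∀ x, φ (fun e => ε e * x e) = -φ x) :
    |noiseCorr κ φ| ≤ ∑ S : Finset E with m ≤ S.card, δ ^ S.card := by
  -- The Boolean label records which summand a pair comes from, with `true` for `η`; forgetting it
  -- recovers `κ`.
  set θ : Measure ((ℝ × ℝ) × Bool) := s.map (fun z => (z, false)) + η.map (fun z => (z, true))
    with θ_def
  have hmk : ∀ b : Bool, Measurable fun z : ℝ × ℝ => (z, b) := fun b => by fun_prop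
  have hθ : θ.map Prod.fst = κ := by
    rw [θ_def, Measure.map_add _ _ measurable_fst, Measure.map_map measurable_fst (hmk _),
      Measure.map_map measurable_fst (hmk _), h]
    simp [Function.comp_def]
  have : IsProbabilityMeasure θ := by
    constructor
    rw [← Set.preimage_univ (f := (Prod.fst : (ℝ × ℝ) × Bool → ℝ × ℝ)),
      ← Measure.map_apply measurable_fst MeasurableSet.univ, hθ, measure_univ]
  have hθt : θ {w | w.2 = true} ≤ ENNReal.ofReal δ := by
    have hms : MeasurableSet {w : (ℝ × ℝ) × Bool | w.2 = true} :=
      measurable_snd (measurableSet_singleton true)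
    rw [θ_def, Measure.add_apply, Measure.map_apply (hmk _) hms, Measure.map_apply (hmk _) hms]
    simpa using hη
  -- The reflection acts on the `s` part only, so it preserves `θ`.
  set r : (ℝ × ℝ) × Bool → (ℝ × ℝ) × Bool :=
    fun w => if w.2 = true then w else ((w.1.1, -w.1.2), w.2) with r_def
  have hrm : Measurable r := by
    refine Measurable.ite (measurable_snd (measurableSet_singleton true)) measurable_id ?_
    fun_prop
  have hr : MeasurePreserving r θ θ := by
    refine ⟨hrm, ?_⟩
    have hflip : Measurable fun z : ℝ × ℝ => (z.1, -z.2) := by fun_prop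
    have e₁ : r ∘ (fun z => (z, false)) = (fun z => (z, false)) ∘ fun z : ℝ × ℝ => (z.1, -z.2) := by
      ext z <;> simp [r_def]
    have e₂ : r ∘ (fun z => (z, true)) = fun z => (z, true) := by
      ext z <;> simp [r_def]
    rw [θ_def, Measure.map_add _ _ hrm, Measure.map_map hrm (hmk _), Measure.map_map hrm (hmk _),
      e₁, e₂, ← Measure.map_map (hmk _) hflip, hs]
  set Θ : Measure (E → (ℝ × ℝ) × Bool) := Measure.pi fun _ => θ with Θ_def
  set ψ : (E → (ℝ × ℝ) × Bool) → ℝ :=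
    fun w => φ (fun e => (w e).1.1) * φ (fun e => (w e).1.2) with ψ_def
  have hψm : Measurable ψ := by fun_prop
  have hψb : ∀ w, |ψ w| ≤ 1 := fun w => abs_mul_le_one (hb _) (hb _)
  set A : Finset E → Set (E → (ℝ × ℝ) × Bool) := fun S => {w | ∀ e, (w e).2 = true ↔ e ∈ S}
    with A_def
  have hA : ∀ S, MeasurableSet (A S) := by
    intro S
    have : A S = ⋂ e, {w | (w e).2 = decide (e ∈ S)} := by
      ext w
      simp only [A_def, Set.mem_ofPred_eq, Set.mem_iInter]
      refine forall_congr' fun e => ?_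
      by_cases he : e ∈ S <;> simp [he]
    rw [this]
    refine MeasurableSet.iInter fun e => ?_
    exact (measurable_snd.comp (measurable_pi_apply e)) (measurableSet_singleton _)
  have hsum : noiseCorr κ φ = ∑ S : Finset E, ∫ w, (A S).indicator ψ w ∂Θ := by
    have hint : ∀ S, Integrable ((A S).indicator ψ) Θ := fun S =>
      (integrable_of_abs_le_one hψm.aemeasurable hψb).indicator (hA S)
    rw [← integral_finsetSum _ fun S _ => hint S, noiseCorr, ← hθ,
      ← Measure.pi_map_pi (fun _ : E => measurable_fst.aemeasurable), integral_map]
    · refine integral_congr_ae (Filter.Eventually.of_forall fun w => ?_)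
      simp only
      rw [Finset.sum_eq_single (Finset.univ.filter fun e => (w e).2 = true)]
      · rw [Set.indicator_of_mem (by simp [A_def])]
      · intro S _ hS
        refine Set.indicator_of_notMem (fun hw => hS ?_) _
        ext e
        simp [hw e]
      · simp
    · exact Measurable.aemeasurable (by fun_prop)
    · refine Measurable.aestronglyMeasurable ?_
      fun_prop
  have hzero : ∀ S : Finset E, S.card < m → ∫ w, (A S).indicator ψ w ∂Θ = 0 := by
    intro S hS
    obtain ⟨ε, hε, hεS, hεφ⟩ := hodd S hS
    set R : (E → (ℝ × ℝ) × Bool) → (E → (ℝ × ℝ) × Bool) :=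
      fun w e => (if ε e = 1 then id else r) (w e) with R_def
    have hR : MeasurePreserving R Θ Θ := by
      refine measurePreserving_pi (fun _ => θ) (fun _ => θ) fun e => ?_
      split_ifs
      · exact MeasurePreserving.id θ
      · exact hr
    have hR2 : ∀ w e, (R w e).2 = (w e).2 := by
      intro w e
      by_cases h1 : ε e = 1
      · simp [R_def, h1]
      · by_cases h2 : (w e).2 = true <;> simp [R_def, r_def, h1, h2]
    have hR11 : ∀ w e, (R w e).1.1 = (w e).1.1 := by
      intro w e
      by_cases h1 : ε e = 1
      · simp [R_def, h1]
      · by_cases h2 : (w e).2 = true <;> simp [R_def, r_def, h1, h2]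
    have hneg : ∀ w, (A S).indicator ψ (R w) = -(A S).indicator ψ w := by
      intro w
      have hmem : R w ∈ A S ↔ w ∈ A S := by simp [A_def, hR2]
      by_cases hw : w ∈ A S
      · rw [Set.indicator_of_mem (hmem.2 hw), Set.indicator_of_mem hw]
        have hR12 : (fun e => (R w e).1.2) = fun e => ε e * (w e).1.2 := by
          ext e
          rcases hε e with h1 | h1
          · simp [R_def, h1]
          · have he : e ∉ S := fun he => by
              have := hεS e he
              rw [h1] at this
              norm_num at this
            have hw2 : (w e).2 = false := by
              have := (hw e).not.2 he
              simpa using this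
            have h2 : ¬ ((-1 : ℝ) = 1) := by norm_num
            simp [R_def, r_def, h1, h2, hw2]
        simp only [ψ_def, hR11, hR12, hεφ]
        ring
      · rw [Set.indicator_of_notMem (fun h => hw (hmem.1 h)), Set.indicator_of_notMem hw, neg_zero]
    have hself : ∫ w, (A S).indicator ψ w ∂Θ = -∫ w, (A S).indicator ψ w ∂Θ := by
      conv_lhs => rw [← hR.map_eq]
      rw [integral_map hR.measurable.aemeasurable
        (hψm.indicator (hA S)).aestronglyMeasurable, ← integral_neg]
      simp only [hneg]
    linarith
  have hle : ∀ S : Finset E, |∫ w, (A S).indicator ψ w ∂Θ| ≤ δ ^ S.card := by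
    intro S
    rw [integral_indicator (hA S)]
    have h1 : |∫ w in A S, ψ w ∂Θ| ≤ 1 * Θ.real (A S) :=
      norm_setIntegral_le_of_norm_le_const (f := ψ) (measure_lt_top _ _) (fun w _ => hψb w)
    have h2 : Θ (A S) ≤ ENNReal.ofReal (δ ^ S.card) := by
      calc Θ (A S) ≤ Θ (Set.univ.pi fun e => if e ∈ S then {w | w.2 = true} else Set.univ) := by
            refine measure_mono fun w hw e _ => ?_
            beta_reduce
            split_ifs with he
            · exact (hw e).2 he
            · trivial
        _ = ∏ e, if e ∈ S then θ {w | w.2 = true} else 1 := by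
            rw [Θ_def, Measure.pi_pi]
            refine Finset.prod_congr rfl fun e _ => ?_
            split_ifs <;> simp
        _ = θ {w | w.2 = true} ^ S.card := by
            rw [Finset.prod_ite_mem, Finset.univ_inter, Finset.prod_const]
        _ ≤ ENNReal.ofReal δ ^ S.card := by gcongr
        _ = ENNReal.ofReal (δ ^ S.card) := (ENNReal.ofReal_pow hδ _).symm
    rw [one_mul] at h1
    exact h1.trans (ENNReal.toReal_le_of_le_ofReal (by positivity) h2)
  rw [hsum, ← Finset.sum_filter_add_sum_filter_not _ (fun S : Finset E => m ≤ S.card),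
    Finset.sum_eq_zero (s := Finset.univ.filter fun S : Finset E => ¬ m ≤ S.card)
      fun S hS => hzero S (not_le.1 (Finset.mem_filter.1 hS).2), add_zero]
  exact (Finset.abs_sum_le_sum_abs _ _).trans (Finset.sum_le_sum fun S _ => hle S)

/-- A semigroup of correlated pair laws whose asymmetric part has mass `O(t)` contracts functions
that are odd under enough sign flips. -/
theorem abs_noiseCorr_le_pow {κ s η : ℝ → Measure (ℝ × ℝ)}
    (hκ : ∀ t, 0 < t → t < 1 → IsProbabilityMeasure (κ t))
    (h : ∀ t, 0 < t → t < 1 → κ t = s t + η t)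
    (hs : ∀ t, 0 < t → t < 1 → (s t).map (fun z => (z.1, -z.2)) = s t)
    {ρ K : ℝ} (h₀ : 0 < ρ) (h₁ : ρ < 1) (hK : 1 ≤ K)
    (hη : ∀ t, 0 < t → t ≤ ρ → η t Set.univ ≤ ENNReal.ofReal (K * t))
    {φ : (E → ℝ) → ℝ} (hφ : Measurable φ) (hb : ∀ x, |φ x| ≤ 1) {m : ℕ}
    (hodd : ∀ S : Finset E, S.card < m → ∃ ε : E → ℝ, (∀ e, ε e = 1 ∨ ε e = -1) ∧
      (∀ e ∈ S, ε e = 1) ∧ ∀ x, φ (fun e => ε e * x e) = -φ x)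
    (hsq : ∀ t, 0 < t → t < 1 → noiseCorr (κ t) φ ^ 2 ≤ noiseCorr (κ (t ^ 2)) φ) :
    |noiseCorr (κ ρ) φ| ≤ ρ ^ m := by
  classical
  -- Each of the sets `S` with `|S| ≥ m` contributes at most `(K t) ^ |S| ≤ K ^ |E| * t ^ m`.
  refine abs_le_pow_of_sq_le (g := fun t => noiseCorr (κ t) φ)
    (C := (Finset.univ.filter fun S : Finset E => m ≤ S.card).card * K ^ Fintype.card E)
    h₀ h₁ hsq fun t ht0 ht => ?_
  have ht1 := ht.trans_lt h₁
  have := hκ t ht0 ht1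
  refine (abs_noiseCorr_le (h t ht0 ht1) (hs t ht0 ht1) (by positivity) (hη t ht0 ht)
    hφ hb hodd).trans ?_
  rw [mul_assoc, ← nsmul_eq_mul]
  refine Finset.sum_le_card_nsmul _ _ _ fun S hS => ?_
  rw [mul_pow]
  exact mul_le_mul (pow_le_pow_right₀ hK (Finset.card_le_univ S))
    (pow_le_pow_of_le_one ht0.le ht1.le (Finset.mem_filter.1 hS).2) (by positivity) (by positivity)

end Decomposition

/-! ### Correlated Gaussian pairs -/

section Gaussian

open scoped NNReal ENNReal

/-- The law of a pair of standard Gaussian variables with correlation `ρ`. -/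
def gaussianPair (ρ : ℝ) : Measure (ℝ × ℝ) :=
  ((gaussianReal 0 1).prod (gaussianReal 0 1)).map fun w => (w.1, ρ * w.1 + √(1 - ρ ^ 2) * w.2)

theorem measurable_gaussianPair_map (ρ : ℝ) :
    Measurable fun w : ℝ × ℝ => (w.1, ρ * w.1 + √(1 - ρ ^ 2) * w.2) := by fun_prop

instance (ρ : ℝ) : IsProbabilityMeasure (gaussianPair ρ) :=
  Measure.isProbabilityMeasure_map (measurable_gaussianPair_map ρ).aemeasurable

theorem gaussianReal_prod_map_add (v₁ v₂ : ℝ≥0) (a b : ℝ) :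
    ((gaussianReal 0 v₁).prod (gaussianReal 0 v₂)).map (fun w => a * w.1 + b * w.2) =
      gaussianReal 0 (.mk (a ^ 2) (sq_nonneg _) * v₁ + .mk (b ^ 2) (sq_nonneg _) * v₂) := by
  have h := gaussianReal_conv_gaussianReal (m₁ := 0) (m₂ := 0)
    (v₁ := .mk (a ^ 2) (sq_nonneg _) * v₁) (v₂ := .mk (b ^ 2) (sq_nonneg _) * v₂)
  have ha := gaussianReal_map_const_mul (μ := 0) (v := v₁) a
  have hb := gaussianReal_map_const_mul (μ := 0) (v := v₂) b
  rw [mul_zero] at ha hb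
  rw [Measure.conv, ← ha, ← hb, Measure.map_prod_map _ _ (by fun_prop) (by fun_prop),
    Measure.map_map (by fun_prop) (by fun_prop), add_zero] at h
  exact h

theorem gaussianPair_map_snd {ρ : ℝ} (hρ : ρ ^ 2 ≤ 1) :
    (gaussianPair ρ).map Prod.snd = gaussianReal 0 1 := by
  rw [gaussianPair, Measure.map_map measurable_snd (measurable_gaussianPair_map ρ)]
  refine (gaussianReal_prod_map_add 1 1 _ _).trans ?_
  congr 1
  ext
  simp [Real.sq_sqrt (sub_nonneg.2 hρ)]

theorem gaussianPair_map_fst (ρ : ℝ) : (gaussianPair ρ).map Prod.fst = gaussianReal 0 1 := by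
  rw [gaussianPair, Measure.map_map measurable_fst (measurable_gaussianPair_map ρ)]
  refine (Measure.map_fst_prod).trans ?_
  simp

/-- Every linear functional of either pair is a centred Gaussian, so equality of laws reduces to
comparing variances. -/
theorem gaussianPair_semigroup {ρ : ℝ} (hρ : ρ ^ 2 ≤ 1) :
    ((gaussianReal 0 1).prod ((gaussianReal 0 1).prod (gaussianReal 0 1))).map
      (fun w => (ρ * w.1 + √(1 - ρ ^ 2) * w.2.1, ρ * w.1 + √(1 - ρ ^ 2) * w.2.2)) =
      gaussianPair (ρ ^ 2) := by
  have hm : Measurable fun w : ℝ × ℝ × ℝ =>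
    (ρ * w.1 + √(1 - ρ ^ 2) * w.2.1, ρ * w.1 + √(1 - ρ ^ 2) * w.2.2) := by fun_prop
  have : IsProbabilityMeasure
      (((gaussianReal 0 1).prod ((gaussianReal 0 1).prod (gaussianReal 0 1))).map
      (fun w => (ρ * w.1 + √(1 - ρ ^ 2) * w.2.1, ρ * w.1 + √(1 - ρ ^ 2) * w.2.2))) :=
    Measure.isProbabilityMeasure_map hm.aemeasurable
  refine Measure.ext_of_charFunDual ?_
  ext L
  have hL : ∀ x y : ℝ, L (x, y) = L (1, 0) * x + L (0, 1) * y := by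
    intro x y
    have : (x, y) = x • ((1 : ℝ), (0 : ℝ)) + y • ((0 : ℝ), (1 : ℝ)) := by simp
    rw [this, map_add, map_smul, map_smul, smul_eq_mul, smul_eq_mul]
    ring
  set a := L (1, 0)
  set b := L (0, 1)
  have hLm : Measurable L := L.continuous.measurable
  rw [charFunDual_eq_charFun_map_one, charFunDual_eq_charFun_map_one]
  congr 1
  rw [gaussianPair, Measure.map_map hLm hm, Measure.map_map hLm (measurable_gaussianPair_map _)]
  have e₁ : L ∘ (fun w : ℝ × ℝ × ℝ =>
      (ρ * w.1 + √(1 - ρ ^ 2) * w.2.1, ρ * w.1 + √(1 - ρ ^ 2) * w.2.2)) =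
      (fun w : ℝ × ℝ => (a + b) * ρ * w.1 + 1 * w.2) ∘ Prod.map id
        (fun w : ℝ × ℝ => a * √(1 - ρ ^ 2) * w.1 + b * √(1 - ρ ^ 2) * w.2) := by
    ext w
    simp only [Function.comp_apply, hL, Prod.map_fst, Prod.map_snd, id]
    ring
  have e₂ : L ∘ (fun w : ℝ × ℝ => (w.1, ρ ^ 2 * w.1 + √(1 - (ρ ^ 2) ^ 2) * w.2)) =
      fun w : ℝ × ℝ => (a + b * ρ ^ 2) * w.1 + b * √(1 - (ρ ^ 2) ^ 2) * w.2 := by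
    ext w
    simp only [Function.comp_apply, hL]
    ring
  rw [e₁, e₂, ← Measure.map_map (by fun_prop) (by fun_prop),
    ← Measure.map_prod_map _ _ (by fun_prop) (by fun_prop), gaussianReal_prod_map_add,
    Measure.map_id, gaussianReal_prod_map_add, gaussianReal_prod_map_add]
  congr 1
  ext
  have h1 := Real.sq_sqrt (sub_nonneg.2 hρ)
  have h2 : √(1 - (ρ ^ 2) ^ 2) ^ 2 = 1 - (ρ ^ 2) ^ 2 :=
    Real.sq_sqrt (sub_nonneg.2 (pow_le_one₀ (sq_nonneg _) hρ))
  simp [mul_pow, h1, h2]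
  ring

theorem gaussianPair_eq_withDensity {ρ : ℝ} (hρ : ρ ^ 2 < 1) :
    gaussianPair ρ = ((gaussianReal 0 1).prod volume).withDensity
      fun z => gaussianPDF (ρ * z.1) (Real.toNNReal (1 - ρ ^ 2)) z.2 := by
  have hv : Real.toNNReal (1 - ρ ^ 2) ≠ 0 := by simpa using hρ
  have hpdf : Measurable fun z : ℝ × ℝ =>
      gaussianPDF (ρ * z.1) (Real.toNNReal (1 - ρ ^ 2)) z.2 :=
    measurable_uncurry_gaussianPDF.comp
      (f := fun z : ℝ × ℝ => (ρ * z.1, Real.toNNReal (1 - ρ ^ 2), z.2)) (by fun_prop)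
  ext A hA
  have hsec : ∀ x : ℝ, (gaussianReal 0 1).map (fun n => ρ * x + √(1 - ρ ^ 2) * n) =
      gaussianReal (ρ * x) (Real.toNNReal (1 - ρ ^ 2)) := by
    intro x
    have := gaussianReal_map_const_mul (μ := 0) (v := 1) (√(1 - ρ ^ 2))
    have h2 := gaussianReal_map_const_add (μ := √(1 - ρ ^ 2) * 0)
      (v := .mk (√(1 - ρ ^ 2) ^ 2) (sq_nonneg _) * 1) (ρ * x)
    rw [← this, Measure.map_map (by fun_prop) (by fun_prop)] at h2
    refine h2.trans ?_
    congr 1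
    · ring
    · ext
      simp [Real.sq_sqrt (sub_nonneg.2 hρ.le), Real.coe_toNNReal _ (sub_nonneg.2 hρ.le)]
  rw [gaussianPair, Measure.map_apply (measurable_gaussianPair_map ρ) hA,
    Measure.prod_apply (measurable_gaussianPair_map ρ hA), withDensity_apply _ hA,
    ← lintegral_indicator hA, lintegral_prod _ (hpdf.indicator hA).aemeasurable]
  refine lintegral_congr fun x => ?_
  have hsA : MeasurableSet (Prod.mk x ⁻¹' A) := measurable_prodMk_left hA
  have : Prod.mk x ⁻¹' ((fun w : ℝ × ℝ => (w.1, ρ * w.1 + √(1 - ρ ^ 2) * w.2)) ⁻¹' A) =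
      (fun n => ρ * x + √(1 - ρ ^ 2) * n) ⁻¹' (Prod.mk x ⁻¹' A) := rfl
  rw [this, ← Measure.map_apply (by fun_prop) hsA, hsec, gaussianReal_apply _ hv,
    ← lintegral_indicator hsA]
  rfl

theorem lintegral_sq_gaussianReal :
    ∫⁻ x, ENNReal.ofReal (x ^ 2) ∂gaussianReal 0 1 = 1 := by
  have hL : MemLp (fun x : ℝ => x) 2 (gaussianReal 0 1) := memLp_id_gaussianReal 2
  have h : ∫ x, x ^ 2 ∂gaussianReal 0 1 = 1 := by
    have h1 := variance_fun_id_gaussianReal (μ := 0) (v := 1)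
    rw [variance_eq_sub hL] at h1
    simpa using h1
  rw [← ofReal_integral_eq_lintegral_ofReal hL.integrable_sq
    (Filter.Eventually.of_forall fun x => sq_nonneg x)]
  simp [h]

/-- The densities at `-y` and `y` have ratio `exp (-2ρxy/v)`; then `1 - exp (-u) ≤ u` and `2xy ≤ x²
+ y²`. -/
theorem gaussianPDFReal_sub_min_le {ρ x y : ℝ} {v : ℝ≥0} (hρ : 0 ≤ ρ) (hv : v ≠ 0) :
    gaussianPDFReal (ρ * x) v y - min (gaussianPDFReal (ρ * x) v y) (gaussianPDFReal (ρ * x) v (-y))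
      ≤ gaussianPDFReal (ρ * x) v y * (ρ / v * (x ^ 2 + y ^ 2)) := by
  have hv0 : (0 : ℝ) < v := by positivity
  set f := gaussianPDFReal (ρ * x) v y with hf
  have hf0 : 0 ≤ f := gaussianPDFReal_nonneg _ _ _
  have hneg : gaussianPDFReal (ρ * x) v (-y) = f * Real.exp (-(2 * ρ * x * y / v)) := by
    rw [hf, gaussianPDFReal, gaussianPDFReal, mul_assoc (√_)⁻¹, ← Real.exp_add]
    congr 2
    field_simp
    ring
  have hK : 0 ≤ ρ / v * (x ^ 2 + y ^ 2) := by positivity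
  rcases min_choice f (gaussianPDFReal (ρ * x) v (-y)) with h | h
  · rw [h, sub_self]
    positivity
  · rw [h, hneg]
    have h1 := Real.add_one_le_exp (-(2 * ρ * x * y / v))
    have h2 : 2 * ρ * x * y / v ≤ ρ / v * (x ^ 2 + y ^ 2) := by
      rw [div_mul_eq_mul_div]
      exact div_le_div_of_nonneg_right (by nlinarith [mul_nonneg hρ (sq_nonneg (x - y))]) hv0.le
    nlinarith [mul_le_mul_of_nonneg_left h1 hf0, mul_le_mul_of_nonneg_left h2 hf0]

/-- The symmetric part has as density the minimum of the conditional density and its reflection. The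
excess is at most `ρ/v * (x² + y²)` times the density, with `v = 1 - ρ²`, and both second moments
are one. -/
theorem exists_gaussianPair_decomposition {ρ : ℝ} (h₀ : 0 ≤ ρ) (h₁ : ρ < 1) :
    ∃ s η : Measure (ℝ × ℝ), gaussianPair ρ = s + η ∧ s.map (fun z => (z.1, -z.2)) = s ∧
      η Set.univ ≤ ENNReal.ofReal (2 / (1 - ρ ^ 2) * ρ) := by
  have hρ2 : ρ ^ 2 < 1 := pow_lt_one₀ h₀ h₁ two_ne_zero
  set v := Real.toNNReal (1 - ρ ^ 2) with v_def
  have hv : v ≠ 0 := by simpa [v_def] using hρ2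
  have hvc : (v : ℝ) = 1 - ρ ^ 2 := Real.coe_toNNReal _ (sub_nonneg.2 hρ2.le)
  set f : ℝ × ℝ → ℝ≥0∞ := fun z => gaussianPDF (ρ * z.1) v z.2 with f_def
  have hf : Measurable f := measurable_uncurry_gaussianPDF.comp
      (f := fun z : ℝ × ℝ => (ρ * z.1, v, z.2)) (by fun_prop)
  set r : ℝ × ℝ → ℝ × ℝ := fun z => (z.1, -z.2) with r_def
  have hr : Measurable r := by fun_prop
  set g : ℝ × ℝ → ℝ≥0∞ := fun z => min (f z) (f (r z)) with g_def
  have hg : Measurable g := hf.min (hf.comp hr)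
  have hgf : g ≤ f := fun z => min_le_left _ _
  set M : Measure (ℝ × ℝ) := (gaussianReal 0 1).prod volume with M_def
  have hrM : MeasurePreserving r M M :=
    (MeasurePreserving.id (gaussianReal 0 1)).prod (Measure.measurePreserving_neg volume)
  have hκ : gaussianPair ρ = M.withDensity f := gaussianPair_eq_withDensity hρ2
  have hgr : ∀ z, g (r z) = g z := fun z => by
    simp only [g_def, r_def, neg_neg]
    exact min_comm _ _
  refine ⟨M.withDensity g, M.withDensity (f - g), ?_, ?_, ?_⟩
  · rw [hκ, ← withDensity_add_left hg, add_tsub_cancel_of_le hgf]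
  · ext A hA
    rw [Measure.map_apply hr hA, withDensity_apply _ (hr hA), withDensity_apply _ hA]
    conv_rhs => rw [← hrM.map_eq]
    rw [setLIntegral_map hA hg hr]
    simp only [hgr]
  · have hpt : ∀ z, (f - g) z ≤ f z *
        (ENNReal.ofReal (ρ / v) * (ENNReal.ofReal (z.1 ^ 2) + ENNReal.ofReal (z.2 ^ 2))) := by
      intro z
      have h := gaussianPDFReal_sub_min_le (x := z.1) (y := z.2) h₀ hv
      rw [Pi.sub_apply, ← ENNReal.ofReal_add (sq_nonneg _) (sq_nonneg _),
        ← ENNReal.ofReal_mul (by positivity)]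
      simp only [g_def, f_def, r_def, gaussianPDF]
      rw [← ENNReal.ofReal_min, ← ENNReal.ofReal_sub _ (le_min (gaussianPDFReal_nonneg _ _ _)
        (gaussianPDFReal_nonneg _ _ _)), ← ENNReal.ofReal_mul (gaussianPDFReal_nonneg _ _ _)]
      exact ENNReal.ofReal_le_ofReal h
    have hsq : Measurable fun x : ℝ => ENNReal.ofReal (x ^ 2) := by fun_prop
    have hq₁ : ∫⁻ z, ENNReal.ofReal (z.1 ^ 2) ∂gaussianPair ρ = 1 := by
      rw [← lintegral_map hsq measurable_fst, gaussianPair_map_fst, lintegral_sq_gaussianReal]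
    have hq₂ : ∫⁻ z, ENNReal.ofReal (z.2 ^ 2) ∂gaussianPair ρ = 1 := by
      rw [← lintegral_map hsq measurable_snd, gaussianPair_map_snd hρ2.le,
        lintegral_sq_gaussianReal]
    rw [withDensity_apply _ MeasurableSet.univ, Measure.restrict_univ]
    calc ∫⁻ z, (f - g) z ∂M
        ≤ ∫⁻ z, f z * (ENNReal.ofReal (ρ / v) *
            (ENNReal.ofReal (z.1 ^ 2) + ENNReal.ofReal (z.2 ^ 2))) ∂M := lintegral_mono hpt
      _ = ∫⁻ z, ENNReal.ofReal (ρ / v) *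
            (ENNReal.ofReal (z.1 ^ 2) + ENNReal.ofReal (z.2 ^ 2)) ∂gaussianPair ρ := by
          rw [hκ, lintegral_withDensity_eq_lintegral_mul _ hf (by fun_prop)]
          rfl
      _ = ENNReal.ofReal (ρ / v) * (1 + 1) := by
          rw [lintegral_const_mul _ (by fun_prop), lintegral_add_left (by fun_prop), hq₁, hq₂]
      _ = ENNReal.ofReal (2 / (1 - ρ ^ 2) * ρ) := by
          rw [hvc, ← ENNReal.ofReal_one, ← ENNReal.ofReal_add zero_le_one zero_le_one,
            ← ENNReal.ofReal_mul (div_nonneg h₀ (sub_nonneg.2 hρ2.le))]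
          congr 1
          ring

theorem abs_noiseCorr_gaussianPair_le {E : Type*} [Fintype E] {ρ : ℝ} (h₀ : 0 < ρ) (h₁ : ρ < 1)
    {φ : (E → ℝ) → ℝ} (hφ : Measurable φ) (hb : ∀ x, |φ x| ≤ 1) {m : ℕ}
    (hodd : ∀ S : Finset E, S.card < m → ∃ ε : E → ℝ, (∀ e, ε e = 1 ∨ ε e = -1) ∧
      (∀ e ∈ S, ε e = 1) ∧ ∀ x, φ (fun e => ε e * x e) = -φ x) :
    |noiseCorr (gaussianPair ρ) φ| ≤ ρ ^ m := by
  choose! s η hsum hs hη using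
    fun t (ht : 0 ≤ t ∧ t < 1) => exists_gaussianPair_decomposition ht.1 ht.2
  -- This `K` dominates `2 / (1 - t ^ 2)` for all `t ≤ ρ`.
  refine abs_noiseCorr_le_pow (s := s) (η := η) (K := 2 / (1 - ρ ^ 2))
    (fun t _ _ => inferInstance) (fun t h h' => hsum t ⟨h.le, h'⟩) (fun t h h' => hs t ⟨h.le, h'⟩)
    h₀ h₁ ?_ (fun t h h' => ?_) hφ hb hodd fun t h h' => ?_
  · rw [one_le_div (by nlinarith)]
    nlinarith
  · refine (hη t ⟨h.le, h'.trans_lt h₁⟩).trans (ENNReal.ofReal_le_ofReal ?_)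
    have : 0 < 1 - ρ ^ 2 := by nlinarith
    gcongr
  · have h2 := gaussianPair_semigroup (pow_le_one₀ (n := 2) h.le h'.le)
    rw [← h2]
    exact noiseCorr_sq_le (F := fun w => t * w.1 + √(1 - t ^ 2) * w.2) (by fun_prop) hφ hb

end Gaussian

/-! ### Resampled pairs -/

section Resampling

open scoped ENNReal

/-- The law of a pair of variables of law `μ` that are equal with probability `ρ` and independent
otherwise. -/
def resampledPair (μ : Measure ℝ) (ρ : ℝ) : Measure (ℝ × ℝ) :=
  ENNReal.ofReal (1 - ρ) • μ.prod μ + ENNReal.ofReal ρ • μ.map fun x => (x, x)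

theorem lintegral_prod_bernoulliMeasure {μ : Measure ℝ} (p : unitInterval) {f : ℝ × Bool → ℝ≥0∞}
    (hf : Measurable f) :
    ∫⁻ n, f n ∂μ.prod (bernoulliMeasure true false p) =
      ENNReal.ofReal p * ∫⁻ y, f (y, true) ∂μ +
        ENNReal.ofReal (1 - p) * ∫⁻ y, f (y, false) ∂μ := by
  have h : ∀ b, Measurable fun y => f (y, b) := fun b => hf.comp (by fun_prop)
  rw [lintegral_prod _ hf.aemeasurable, ← lintegral_const_mul _ (h _),
    ← lintegral_const_mul _ (h _), ← lintegral_add_left ((h _).const_mul _)]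
  refine lintegral_congr fun y => ?_
  rw [bernoulliMeasure_def, lintegral_add_measure, lintegral_smul_measure, lintegral_smul_measure,
    lintegral_dirac, lintegral_dirac]
  exact congrArg₂ (· * f (y, true) + · * f (y, false))
    (ENNReal.ofReal_coe_nnreal (p := unitInterval.toNNReal p)).symm
    (ENNReal.ofReal_coe_nnreal (p := unitInterval.toNNReal (unitInterval.symm p))).symm

variable {μ : Measure ℝ} [IsProbabilityMeasure μ]

theorem measurable_diag : Measurable fun x : ℝ => (x, x) := by fun_prop

theorem isProbabilityMeasure_resampledPair {ρ : ℝ} (h₀ : 0 ≤ ρ) (h₁ : ρ ≤ 1) :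
    IsProbabilityMeasure (resampledPair μ ρ) := by
  have := Measure.isProbabilityMeasure_map (μ := μ) measurable_diag.aemeasurable
  constructor
  simp only [resampledPair, Measure.add_apply, Measure.smul_apply, measure_univ, smul_eq_mul,
    mul_one]
  rw [← ENNReal.ofReal_add (by linarith) h₀]
  simp

theorem resampledPair_map_snd {ρ : ℝ} (h₀ : 0 ≤ ρ) (h₁ : ρ ≤ 1) :
    (resampledPair μ ρ).map Prod.snd = μ := by
  have h : ENNReal.ofReal (1 - ρ) + ENNReal.ofReal ρ = 1 := by
    rw [← ENNReal.ofReal_add (by linarith) h₀]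
    simp
  rw [resampledPair, Measure.map_add _ _ measurable_snd, Measure.map_smul, Measure.map_smul,
    Measure.map_snd_prod, Measure.map_map measurable_snd measurable_diag]
  simp [Function.comp_def, ← add_smul, h]

theorem lintegral_resampledPair (ρ : ℝ) {f : ℝ × ℝ → ℝ≥0∞} (hf : Measurable f) :
    ∫⁻ z, f z ∂resampledPair μ ρ =
      ENNReal.ofReal (1 - ρ) * ∫⁻ x, ∫⁻ y, f (x, y) ∂μ ∂μ +
        ENNReal.ofReal ρ * ∫⁻ x, f (x, x) ∂μ := by
  rw [resampledPair, lintegral_add_measure, lintegral_smul_measure, lintegral_smul_measure,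
    lintegral_map hf measurable_diag, lintegral_prod _ hf.aemeasurable]
  rfl

/-- The value after resampling: the new value if the Boolean is `true`, the old one otherwise. -/
def resample (w : ℝ × ℝ × Bool) : ℝ := if w.2.2 = true then w.2.1 else w.1

theorem measurable_resample : Measurable resample := by
  refine Measurable.ite ?_ (by fun_prop) (by fun_prop)
  exact (measurable_snd.comp measurable_snd) (measurableSet_singleton true)

theorem map_resample_eq (p : unitInterval) :
    (μ.prod (μ.prod (bernoulliMeasure true false p))).map (fun w => (w.1, resample w)) =
      resampledPair μ (1 - p) := by
  refine Measure.ext_of_lintegral _ fun f hf => ?_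
  have hm : Measurable fun w : ℝ × ℝ × Bool => (w.1, resample w) :=
    measurable_fst.prodMk measurable_resample
  rw [lintegral_map hf hm, lintegral_prod (fun w : ℝ × ℝ × Bool => f (w.1, resample w))
    (hf.comp hm).aemeasurable, lintegral_resampledPair _ hf, sub_sub_cancel]
  have hin : ∀ x, ∫⁻ n, f (x, resample (x, n)) ∂μ.prod (bernoulliMeasure true false p) =
      ENNReal.ofReal p * ∫⁻ y, f (x, y) ∂μ + ENNReal.ofReal (1 - p) * f (x, x) := by
    intro x
    have := measurable_resample
    rw [lintegral_prod_bernoulliMeasure p (by fun_prop)]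
    simp [resample]
  have h2 : Measurable fun x => ∫⁻ y, f (x, y) ∂μ := hf.lintegral_prod_right'
  simp only [hin]
  rw [lintegral_add_left (by fun_prop), lintegral_const_mul _ h2, lintegral_const_mul _ (by fun_prop)]

/-- Two independent resamplings of one value agree when both keep it, with probability `(1 - p) ^
2`; in every other case the two results are independent of law `μ`. -/
theorem resampledPair_semigroup (p : unitInterval) :
    (μ.prod ((μ.prod (bernoulliMeasure true false p)).prod
      (μ.prod (bernoulliMeasure true false p)))).map
      (fun w => (resample (w.1, w.2.1), resample (w.1, w.2.2))) =
      resampledPair μ ((1 - p) ^ 2) := by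
  refine Measure.ext_of_lintegral _ fun f hf => ?_
  have hR := measurable_resample
  have hm : Measurable fun w : ℝ × (ℝ × Bool) × (ℝ × Bool) =>
    (resample (w.1, w.2.1), resample (w.1, w.2.2)) := by fun_prop
  set a := ENNReal.ofReal p with ha
  set b := ENNReal.ofReal (1 - p) with hb
  rw [lintegral_map hf hm, lintegral_prod (fun w : ℝ × (ℝ × Bool) × (ℝ × Bool) =>
    f (resample (w.1, w.2.1), resample (w.1, w.2.2))) (hf.comp hm).aemeasurable,
    lintegral_resampledPair _ hf]
  have h2 : Measurable fun x => ∫⁻ y, f (x, y) ∂μ := hf.lintegral_prod_right'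
  have h3 : Measurable fun x => ∫⁻ y, f (y, x) ∂μ := hf.lintegral_prod_left'
  have hin : ∀ x, ∫⁻ n, f (resample (x, n.1), resample (x, n.2))
      ∂(μ.prod (bernoulliMeasure true false p)).prod (μ.prod (bernoulliMeasure true false p)) =
      a * (a * ∫⁻ y, ∫⁻ y', f (y, y') ∂μ ∂μ + b * ∫⁻ y, f (y, x) ∂μ) +
        b * (a * ∫⁻ y', f (x, y') ∂μ + b * f (x, x)) := by
    intro x
    have hinner : ∀ c, ∫⁻ n, f (c, resample (x, n)) ∂μ.prod (bernoulliMeasure true false p) =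
        a * ∫⁻ y', f (c, y') ∂μ + b * f (c, x) := by
      intro c
      rw [lintegral_prod_bernoulliMeasure p (by fun_prop)]
      simp [resample, ha, hb]
    rw [lintegral_prod _ (by fun_prop)]
    simp only [hinner]
    rw [lintegral_prod_bernoulliMeasure p (by fun_prop)]
    simp only [resample, if_true, Bool.false_eq_true, if_false, lintegral_const, measure_univ,
      mul_one]
    rw [lintegral_add_left (by fun_prop), lintegral_const_mul _ h2,
      lintegral_const_mul _ (by fun_prop)]
  simp only [hin]
  rw [lintegral_add_left (by fun_prop), lintegral_const_mul _ (by fun_prop),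
    lintegral_const_mul _ (by fun_prop), lintegral_add_left (by fun_prop),
    lintegral_add_left (by fun_prop), lintegral_const_mul _ (by fun_prop),
    lintegral_const_mul _ (by fun_prop), lintegral_const_mul _ (by fun_prop),
    lintegral_const_mul _ (by fun_prop),
    lintegral_lintegral_swap (f := fun x y => f (y, x)) (by fun_prop)]
  simp only [lintegral_const, measure_univ, mul_one]
  have hc₁ : ENNReal.ofReal (1 - (1 - p) ^ 2) = a * a + a * b + b * a := by
    have := p.2.1
    have := p.2.2
    rw [ha, hb, ← ENNReal.ofReal_mul (by linarith), ← ENNReal.ofReal_mul (by linarith),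
      ← ENNReal.ofReal_mul (by linarith), ← ENNReal.ofReal_add (by nlinarith) (by nlinarith),
      ← ENNReal.ofReal_add (by nlinarith) (by nlinarith)]
    congr 1
    ring
  have hc₂ : ENNReal.ofReal ((1 - p) ^ 2) = b * b := by
    rw [sq, ENNReal.ofReal_mul (by linarith [p.2.2])]
  rw [hc₁, hc₂]
  ring

theorem abs_noiseCorr_resampledPair_le (hμ : μ.map (fun x => -x) = μ)
    {E : Type*} [Fintype E] {ρ : ℝ} (h₀ : 0 < ρ) (h₁ : ρ < 1)
    {φ : (E → ℝ) → ℝ} (hφ : Measurable φ) (hb : ∀ x, |φ x| ≤ 1) {m : ℕ}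
    (hodd : ∀ S : Finset E, S.card < m → ∃ ε : E → ℝ, (∀ e, ε e = 1 ∨ ε e = -1) ∧
      (∀ e ∈ S, ε e = 1) ∧ ∀ x, φ (fun e => ε e * x e) = -φ x) :
    |noiseCorr (resampledPair μ ρ) φ| ≤ ρ ^ m := by
  refine abs_noiseCorr_le_pow (s := fun t => ENNReal.ofReal (1 - t) • μ.prod μ)
    (η := fun t => ENNReal.ofReal t • μ.map fun x => (x, x)) (K := 1)
    (fun t h h' => isProbabilityMeasure_resampledPair h.le h'.le) (fun t h h' => rfl)
    (fun t h h' => ?_) h₀ h₁ le_rfl (fun t h h' => ?_) hφ hb hodd fun t h h' => ?_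
  · have hmap : (μ.prod μ).map (Prod.map id fun x => -x) = μ.prod μ := by
      rw [← Measure.map_prod_map _ _ measurable_id measurable_neg, hμ, Measure.map_id]
    rw [Measure.map_smul]
    congr 1
  · have := Measure.isProbabilityMeasure_map (μ := μ) measurable_diag.aemeasurable
    simp
  -- Parameter `t` corresponds to resampling with probability `1 - t`.
  · have h1 := map_resample_eq (μ := μ) ⟨1 - t, by linarith, by linarith⟩
    have h2 := resampledPair_semigroup (μ := μ) ⟨1 - t, by linarith, by linarith⟩
    simp only [sub_sub_cancel] at h1 h2
    rw [← h1, ← h2]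
    exact noiseCorr_sq_le measurable_resample hφ hb

end Resampling

/-! ### Gauge symmetry of ground states and the overlap observable -/

section Gauge

variable {V : Type*}

@[simp]
theorem bondSpin_mk (σ : V → ℤˣ) (i j : V) : bondSpin σ s(i, j) = ((σ i * σ j : ℤˣ) : ℝ) := rfl

theorem bondSpin_mul (σ τ : V → ℤˣ) (e : Sym2 V) :
    bondSpin (σ * τ) e = bondSpin σ e * bondSpin τ e := by
  induction e with
  | _ i j =>
    simp only [bondSpin_mk, Pi.mul_apply]
    push_cast
    ring

theorem bondSpin_eq_one_or (σ : V → ℤˣ) (e : Sym2 V) : bondSpin σ e = 1 ∨ bondSpin σ e = -1 := by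
  induction e with
  | _ i j =>
    rw [bondSpin_mk]
    rcases Int.units_eq_one_or (σ i * σ j) with h | h <;> simp [h]

theorem bondSpin_mul_self (σ : V → ℤˣ) (e : Sym2 V) : bondSpin σ e * bondSpin σ e = 1 := by
  rcases bondSpin_eq_one_or σ e with h | h <;> simp [h]

variable {G : SimpleGraph V} {B : Set V}

/-- The gauge transformation of an environment by a spin configuration `τ`. -/
def gauge (τ : V → ℤˣ) (J : G.edgeSet → ℝ) : G.edgeSet → ℝ :=
  fun e => bondSpin τ (e : Sym2 V) * J e

theorem gauge_gauge (τ : V → ℤˣ) (J : G.edgeSet → ℝ) : gauge τ (gauge τ J) = J := by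
  ext e
  rw [gauge, gauge, ← mul_assoc, bondSpin_mul_self, one_mul]

theorem mul_self_eq_one_fun (τ : V → ℤˣ) : τ * τ = 1 := by
  ext v
  simp

theorem satisfiesBoundary_mul {γ : B → ℤˣ} {τ σ : V → ℤˣ} (hτ : ∀ k ∈ B, τ k = 1) :
    SatisfiesBoundary γ (τ * σ) ↔ SatisfiesBoundary γ σ := by
  simp only [SatisfiesBoundary, Pi.mul_apply]
  exact forall_congr' fun k => by rw [hτ k k.2, one_mul]

variable [Fintype G.edgeSet]

theorem hamiltonian_gauge (τ σ : V → ℤˣ) (J : G.edgeSet → ℝ) :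
    hamiltonian G (gauge τ J) (τ * σ) = hamiltonian G J σ := by
  simp only [hamiltonian, gauge, bondSpin_mul]
  congr 1
  refine Finset.sum_congr rfl fun e _ => ?_
  linear_combination J e * bondSpin σ e * bondSpin_mul_self τ e

theorem isGroundState_gauge {γ : B → ℤˣ} {τ σ : V → ℤˣ} {J : G.edgeSet → ℝ}
    (hτ : ∀ k ∈ B, τ k = 1) (h : IsGroundState G γ J σ) :
    IsGroundState G γ (gauge τ J) (τ * σ) := by
  refine ⟨(satisfiesBoundary_mul hτ).2 h.1, fun ω hω => ?_⟩
  have hω' : τ * (τ * ω) = ω := by rw [← mul_assoc, mul_self_eq_one_fun, one_mul]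
  rw [hamiltonian_gauge, ← hω', hamiltonian_gauge]
  exact h.2 _ ((satisfiesBoundary_mul hτ).2 hω)

/-- The environments that have a ground state with `σ_i σ_j = u`. -/
def overlapSet (G : SimpleGraph V) [Fintype G.edgeSet] {B : Set V} (γ : B → ℤˣ) (i j : V)
    (u : ℤˣ) : Set (G.edgeSet → ℝ) :=
  {J | ∃ σ, IsGroundState G γ J σ ∧ σ i * σ j = u}

theorem gauge_mem_overlapSet {γ : B → ℤˣ} {τ : V → ℤˣ} {i j : V} (hτ : ∀ k ∈ B, τ k = 1)
    (hij : τ i * τ j = -1) {u : ℤˣ} {J : G.edgeSet → ℝ} :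
    gauge τ J ∈ overlapSet G γ i j u ↔ J ∈ overlapSet G γ i j (-u) := by
  have key : ∀ {J : G.edgeSet → ℝ} {u : ℤˣ}, J ∈ overlapSet G γ i j u →
      gauge τ J ∈ overlapSet G γ i j (-u) := by
    rintro J u ⟨σ, hσ, rfl⟩
    refine ⟨τ * σ, isGroundState_gauge hτ hσ, ?_⟩
    rw [Pi.mul_apply, Pi.mul_apply, mul_mul_mul_comm, hij, neg_one_mul]
  refine ⟨fun h => ?_, fun h => ?_⟩
  · have := key h
    rwa [gauge_gauge] at this
  · have := key h
    rwa [neg_neg] at this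

theorem measurable_hamiltonian (σ : V → ℤˣ) :
    Measurable fun J : G.edgeSet → ℝ => hamiltonian G J σ := by
  unfold hamiltonian
  fun_prop

theorem measurableSet_isGroundState [Finite V] (γ : B → ℤˣ) (σ : V → ℤˣ) :
    MeasurableSet {J : G.edgeSet → ℝ | IsGroundState G γ J σ} := by
  simp only [IsGroundState, Set.ofPred_and, Set.ofPred_forall]
  refine (MeasurableSet.const _).inter (MeasurableSet.iInter fun τ => MeasurableSet.iInter fun _ => ?_)
  exact measurableSet_le (measurable_hamiltonian σ) (measurable_hamiltonian τ)

theorem measurableSet_overlapSet [Finite V] (γ : B → ℤˣ) (i j : V) (u : ℤˣ) :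
    MeasurableSet (overlapSet G γ i j u) := by
  simp only [overlapSet, Set.ofPred_exists, Set.ofPred_and]
  exact MeasurableSet.iUnion fun σ => (measurableSet_isGroundState γ σ).inter (MeasurableSet.const _)

/-- The value of `σ_i σ_j` in a ground state `σ`, and `0` where both values occur. -/
def overlap (G : SimpleGraph V) [Fintype G.edgeSet] {B : Set V} (γ : B → ℤˣ) (i j : V)
    (J : G.edgeSet → ℝ) : ℝ :=
  (overlapSet G γ i j 1).indicator 1 J - (overlapSet G γ i j (-1)).indicator 1 J

theorem measurable_overlap [Finite V] (γ : B → ℤˣ) (i j : V) :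
    Measurable (overlap G γ i j) :=
  (measurable_one.indicator (measurableSet_overlapSet γ i j 1)).sub
    (measurable_one.indicator (measurableSet_overlapSet γ i j (-1)))

theorem abs_overlap_le_one (γ : B → ℤˣ) (i j : V) (J : G.edgeSet → ℝ) :
    |overlap G γ i j J| ≤ 1 := by
  classical
  simp only [overlap, Set.indicator_apply, Pi.one_apply]
  split_ifs <;> norm_num

/-- The gauge transformation exchanges the two overlap sets. The value `0` at ties makes the oddness
hold for every `J`, not just almost every one. -/
theorem overlap_gauge {γ : B → ℤˣ} {τ : V → ℤˣ} {i j : V} (hτ : ∀ k ∈ B, τ k = 1)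
    (hij : τ i * τ j = -1) (J : G.edgeSet → ℝ) :
    overlap G γ i j (gauge τ J) = -overlap G γ i j J := by
  classical
  simp only [overlap, Set.indicator_apply, gauge_mem_overlapSet hτ hij, Pi.one_apply, neg_neg,
    neg_sub]

theorem overlap_eq {γ : B → ℤˣ} {i j : V} {J : G.edgeSet → ℝ} {σ : V → ℤˣ}
    (hσ : IsGroundState G γ J σ)
    (huniq : J ∉ overlapSet G γ i j 1 ∩ overlapSet G γ i j (-1)) :
    overlap G γ i j J = ((σ i * σ j : ℤˣ) : ℝ) := by
  classical
  have hmem : J ∈ overlapSet G γ i j (σ i * σ j) := ⟨σ, hσ, rfl⟩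
  simp only [overlap, Set.indicator_apply]
  rcases Int.units_eq_one_or (σ i * σ j) with h | h <;> rw [h] at hmem ⊢
  · have : J ∉ overlapSet G γ i j (-1) := fun h' => huniq ⟨hmem, h'⟩
    simp [hmem, this]
  · have : J ∉ overlapSet G γ i j 1 := fun h' => huniq ⟨h', hmem⟩
    simp [hmem, this]

end Gauge

/-! ### Small edge sets fail to separate-proof: a gauge avoiding them -/

section Separation

variable {V : Type*} {G : SimpleGraph V} {B : Set V}

theorem length_le_card_of_isPath {H : SimpleGraph V} {i j : V} {w : H.Walk i j} (hw : w.IsPath)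
    {T : Finset (Sym2 V)} (hT : H.edgeSet ⊆ T) : w.length ≤ T.card := by
  classical
  rw [← w.length_edges, ← List.toFinset_card_of_nodup hw.isTrail.edges_nodup]
  refine Finset.card_le_card fun e he => hT ?_
  exact w.edges_subset_edgeSet (List.mem_toFinset.1 he)

/-- The two paths lie in different components of `H`, so they share no edge. -/
theorem length_add_length_le_card {H : SimpleGraph V} {i j k l : V} {w : H.Walk i k}
    (hw : w.IsPath) {w' : H.Walk j l} (hw' : w'.IsPath) (hij : ¬ H.Reachable i j)
    {T : Finset (Sym2 V)} (hT : H.edgeSet ⊆ T) : w.length + w'.length ≤ T.card := by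
  classical
  have hdisj : w.edges.Disjoint w'.edges := by
    intro e he he'
    induction e with
    | _ a b =>
      have ha := w.fst_mem_support_of_mem_edges he
      have ha' := w'.fst_mem_support_of_mem_edges he'
      exact hij (((w.takeUntil a ha).reachable).trans ((w'.takeUntil a ha').reachable).symm)
  have hnd : (w.edges ++ w'.edges).Nodup :=
    List.Nodup.append hw.isTrail.edges_nodup hw'.isTrail.edges_nodup hdisj
  rw [← w.length_edges, ← w'.length_edges, ← List.length_append, ← List.toFinset_card_of_nodup hnd]
  refine Finset.card_le_card fun e he => hT ?_
  rcases List.mem_append.1 (List.mem_toFinset.1 he) with h | h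
  · exact w.edges_subset_edgeSet h
  · exact w'.edges_subset_edgeSet h

theorem distToSet_le {i k : V} (hk : k ∈ B) (w : G.Walk i k) : distToSet G i B ≤ w.length :=
  (iInf₂_le k hk).trans (SimpleGraph.edist_le w)

/-- Take `τ = -1` exactly on the `H`-component of `i`: no edge of `H` leaves it, and it misses `B`
and `j`. -/
theorem exists_gauge_of_not_reachable {H : SimpleGraph V} {i j : V}
    (hij : ¬ H.Reachable i j) (hB : ∀ k ∈ B, ¬ H.Reachable i k) :
    ∃ τ : V → ℤˣ, (∀ k ∈ B, τ k = 1) ∧ (∀ e ∈ H.edgeSet, bondSpin τ e = 1) ∧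
      τ i * τ j = -1 := by
  classical
  refine ⟨fun v => if H.Reachable i v then -1 else 1, fun k hk => if_neg (hB k hk), ?_, ?_⟩
  · intro e he
    induction e with
    | _ a b =>
      have hab : H.Adj a b := he
      have : H.Reachable i a ↔ H.Reachable i b :=
        ⟨fun h => h.trans hab.reachable, fun h => h.trans hab.symm.reachable⟩
      rw [bondSpin_mk]
      by_cases h : H.Reachable i a
      · simp [h, this.1 h]
      · simp [h, mt this.2 h]
  · simp [hij]

/-- In the graph with edge set `S`, there are too few edges for a path from `i` to `j`, or for two
disjoint paths from `i` and `j` to `B`. Hence `i` or `j` has a component that misses `B` and the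
other vertex. -/
theorem exists_gauge_of_card_lt_chaosExponent {i j : V} (S : Finset G.edgeSet)
    (hS : (S.card : ℕ∞) < chaosExponent G B i j) :
    ∃ τ : V → ℤˣ, (∀ k ∈ B, τ k = 1) ∧ (∀ e ∈ S, bondSpin τ (e : Sym2 V) = 1) ∧
      τ i * τ j = -1 := by
  classical
  set T : Finset (Sym2 V) := S.image Subtype.val with T_def
  set H : SimpleGraph V := SimpleGraph.fromEdgeSet (T : Set (Sym2 V)) with H_def
  have hT : H.edgeSet ⊆ T := by
    rw [H_def, SimpleGraph.edgeSet_fromEdgeSet]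
    exact Set.sdiff_subset
  have hTS : T.card ≤ S.card := Finset.card_image_le
  have hHG : H ≤ G := by
    rw [← SimpleGraph.edgeSet_subset_edgeSet]
    refine hT.trans fun e he => ?_
    obtain ⟨e', _, rfl⟩ := Finset.mem_image.1 (Finset.mem_coe.1 he)
    exact e'.2
  have hSH : ∀ e ∈ S, (e : Sym2 V) ∈ H.edgeSet := by
    intro e he
    rw [H_def, SimpleGraph.edgeSet_fromEdgeSet]
    exact ⟨Finset.mem_image_of_mem _ he, G.not_isDiag_of_mem_edgeSet e.2⟩
  have hij : ¬ H.Reachable i j := by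
    rintro h
    obtain ⟨w, hw⟩ := h.exists_isPath
    refine absurd hS (not_lt.2 ((min_le_left _ _).trans ?_))
    refine (SimpleGraph.edist_le (w.mapLe hHG)).trans ?_
    rw [SimpleGraph.Walk.length_map]
    exact_mod_cast (length_le_card_of_isPath hw hT).trans hTS
  by_cases hi : ∃ k ∈ B, H.Reachable i k
  · by_cases hj : ∃ l ∈ B, H.Reachable j l
    · exfalso
      obtain ⟨k, hk, hik⟩ := hi
      obtain ⟨l, hl, hjl⟩ := hj
      obtain ⟨w, hw⟩ := hik.exists_isPath
      obtain ⟨w', hw'⟩ := hjl.exists_isPath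
      refine absurd hS (not_lt.2 ((min_le_right _ _).trans ?_))
      refine (add_le_add (distToSet_le hk (w.mapLe hHG)) (distToSet_le hl (w'.mapLe hHG))).trans ?_
      rw [SimpleGraph.Walk.length_map, SimpleGraph.Walk.length_map]
      exact_mod_cast (length_add_length_le_card hw hw' hij hT).trans hTS
    · push Not at hj
      obtain ⟨τ, h₁, h₂, h₃⟩ := exists_gauge_of_not_reachable (fun h => hij h.symm) hj
      exact ⟨τ, h₁, fun e he => h₂ e (hSH e he), by rwa [mul_comm]⟩
  · push Not at hi
    obtain ⟨τ, h₁, h₂, h₃⟩ := exists_gauge_of_not_reachable hij hi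
    exact ⟨τ, h₁, fun e he => h₂ e (hSH e he), h₃⟩

theorem exists_sign_overlap_odd [Fintype G.edgeSet] (γ : B → ℤˣ) {i j : V}
    (S : Finset G.edgeSet) (hS : S.card < (chaosExponent G B i j).toNat) :
    ∃ ε : G.edgeSet → ℝ, (∀ e, ε e = 1 ∨ ε e = -1) ∧ (∀ e ∈ S, ε e = 1) ∧
      ∀ J, overlap G γ i j (fun e => ε e * J e) = -overlap G γ i j J := by
  obtain ⟨τ, h₁, h₂, h₃⟩ := exists_gauge_of_card_lt_chaosExponent (B := B) (i := i) (j := j) S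
    ((Nat.cast_lt.2 hS).trans_le (ENat.natCast_toNat_le_self _))
  exact ⟨fun e => bondSpin τ e, fun e => bondSpin_eq_one_or τ e, h₂, overlap_gauge h₁ h₃⟩

end Separation

/-! ### Almost sure uniqueness of the overlap -/

section Uniqueness

/-- By Fubini: with all coordinates but one fixed, where that one has nonzero coefficient, the
equation determines it, and `μ` has no atoms. -/
theorem pi_linear_hyperplane_null {E : Type*} [Fintype E] {μ : Measure ℝ} [SigmaFinite μ]
    [NullSingletonClass μ] {c : E → ℝ} (hc : c ≠ 0) :
    Measure.pi (fun _ : E => μ) {x | ∑ e, c e * x e = 0} = 0 := by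
  classical
  obtain ⟨e₀, he₀⟩ : ∃ e₀, c e₀ ≠ 0 := by simpa using Function.ne_iff.1 hc
  set Φ := MeasurableEquiv.piEquivPiSubtypeProd (fun _ : E => ℝ) (fun e => e ≠ e₀) with Φ_def
  have hΦ := (measurePreserving_piEquivPiSubtypeProd (fun _ : E => μ) (fun e => e ≠ e₀)).symm
  have hms : MeasurableSet {x : E → ℝ | ∑ e, c e * x e = 0} :=
    measurableSet_eq_fun (by fun_prop) measurable_const
  rw [← hΦ.measure_preimage hms.nullMeasurableSet, Measure.measure_prod_null (Φ.symm.measurable hms)]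
  refine Filter.Eventually.of_forall fun y => ?_
  set T : Set ({e : E // ¬ e ≠ e₀} → ℝ) :=
    Prod.mk y ⁻¹' (Φ.symm ⁻¹' {x : E → ℝ | ∑ e, c e * x e = 0}) with T_def
  change _ = 0
  rcases T.eq_empty_or_nonempty with hT | ⟨z₀, hz₀⟩
  · exact (congrArg _ hT).trans measure_empty
  · refine measure_mono_null (t := {z | z ⟨e₀, by simp⟩ = z₀ ⟨e₀, by simp⟩}) (fun z hz => ?_)
      (Measure.pi_hyperplane _ _ _)
    have h₁ : ∑ e, c e * Φ.symm (y, z) e = 0 := hz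
    have h₀ : ∑ e, c e * Φ.symm (y, z₀) e = 0 := hz₀
    have hval : ∀ z e, Φ.symm (y, z) e =
        if h : e ≠ e₀ then y ⟨e, h⟩ else z ⟨e, h⟩ := fun _ _ => rfl
    have hsub : ∑ e, c e * (Φ.symm (y, z) e - Φ.symm (y, z₀) e) = 0 := by
      simp only [mul_sub, Finset.sum_sub_distrib, h₁, h₀, sub_zero]
    rw [Finset.sum_eq_single e₀ (fun e _ he => by simp [hval, he]) (by simp)] at hsub
    have := (mul_eq_zero.1 hsub).resolve_left he₀
    simpa [hval, sub_eq_zero] using this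

variable {V : Type*} {G : SimpleGraph V}

theorem mul_eq_mul_of_bondSpin_eq {σ τ : V → ℤˣ}
    (h : ∀ e ∈ G.edgeSet, bondSpin σ e = bondSpin τ e) {i j : V} (hij : G.Reachable i j) :
    σ i * σ j = τ i * τ j := by
  obtain ⟨w⟩ := hij
  induction w with
  | nil => rw [Int.units_mul_self, Int.units_mul_self]
  | @cons a b c hab _ ih =>
    have he : σ a * σ b = τ a * τ b := by
      have := h s(a, b) hab
      simp only [bondSpin_mk] at this
      exact Units.ext (by exact_mod_cast this)
    calc σ a * σ c = (σ a * σ b) * (σ b * σ c) := by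
          rw [mul_assoc, ← mul_assoc (σ b), Int.units_mul_self, one_mul]
      _ = (τ a * τ b) * (τ b * τ c) := by rw [he, ih]
      _ = τ a * τ c := by rw [mul_assoc, ← mul_assoc (τ b), Int.units_mul_self, one_mul]

/-- Configurations with different `σ_i σ_j` differ in a bond spin on a path from `i` to `j`, so
equality of their energies is a nontrivial linear equation in `J`. There are finitely many pairs of
configurations. -/
theorem ae_notMem_overlapSet_inter [Finite V] [Fintype G.edgeSet] {B : Set V} (γ : B → ℤˣ)
    {i j : V} (hij : G.Reachable i j) :
    ∀ᵐ J ∂gaussianDisorder G.edgeSet,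
      J ∉ overlapSet G γ i j 1 ∩ overlapSet G γ i j (-1) := by
  have hna : NullSingletonClass (gaussianReal 0 1) := nullSingletonClass_gaussianReal one_ne_zero
  have hpair : ∀ σ τ : V → ℤˣ, σ i * σ j ≠ τ i * τ j →
      ∀ᵐ J ∂gaussianDisorder G.edgeSet, hamiltonian G J σ ≠ hamiltonian G J τ := by
    intro σ τ hne
    have hc : (fun e : G.edgeSet => bondSpin σ e - bondSpin τ e) ≠ 0 := by
      intro h0
      refine hne (mul_eq_mul_of_bondSpin_eq (fun e he => ?_) hij)
      exact sub_eq_zero.1 (congrFun h0 ⟨e, he⟩)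
    refine measure_mono_null (fun J hJ => ?_)
      (pi_linear_hyperplane_null (μ := gaussianReal 0 1) hc)
    have hJ' : hamiltonian G J σ = hamiltonian G J τ := not_not.1 hJ
    simp only [hamiltonian, neg_inj] at hJ'
    change ∑ e : G.edgeSet, (bondSpin σ e - bondSpin τ e) * J e = 0
    simp only [mul_comm _ (J _), mul_sub, Finset.sum_sub_distrib, hJ', sub_self]
  have hall : ∀ᵐ J ∂gaussianDisorder G.edgeSet, ∀ σ τ : V → ℤˣ, σ i * σ j ≠ τ i * τ j →
      hamiltonian G J σ ≠ hamiltonian G J τ := by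
    refine ae_all_iff.2 fun σ => ae_all_iff.2 fun τ => ?_
    by_cases h : σ i * σ j = τ i * τ j
    · exact Filter.Eventually.of_forall fun J h' => absurd h h'
    · filter_upwards [hpair σ τ h] with J hJ _ using hJ
  filter_upwards [hall] with J hJ
  rintro ⟨⟨σ, hσ, hσ1⟩, ⟨τ, hτ, hτ1⟩⟩
  refine hJ σ τ ?_ (le_antisymm (hσ.2 τ hτ.1) (hτ.2 σ hσ.1))
  rw [hσ1, hτ1]
  decide

end Uniqueness

/-! ### Joint law of the environment and its perturbation -/

section PairLaw

variable {Ω E : Type*} [MeasurableSpace Ω] [Fintype E] {P : Measure Ω}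

theorem hasLaw_pi_map {α β δ : Type*} [MeasurableSpace α] [MeasurableSpace β] [MeasurableSpace δ]
    [IsFiniteMeasure P] {μ : Measure α} {ν : Measure β} [IsProbabilityMeasure μ]
    [IsProbabilityMeasure ν]
    {X : Ω → E → α} {Y : Ω → E → β} (hX : HasLaw X (Measure.pi fun _ => μ) P)
    (hY : HasLaw Y (Measure.pi fun _ => ν) P) (hXY : IndepFun X Y P)
    {F : α × β → δ} (hF : Measurable F) :
    HasLaw (fun ω e => F (X ω e, Y ω e)) (Measure.pi fun _ => (μ.prod ν).map F) P := by
  have := Measure.isProbabilityMeasure_map (μ := μ.prod ν) hF.aemeasurable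
  have h₁ := hXY.hasLaw_prod hX hY
  have h₂ := (measurePreserving_arrowProdEquivProdArrow α β E (fun _ => μ) (fun _ => ν)).symm
  have h₃ : MeasurePreserving (fun (w : E → α × β) e => F (w e))
      (Measure.pi fun _ => μ.prod ν) (Measure.pi fun _ => (μ.prod ν).map F) :=
    measurePreserving_pi _ _ fun _ => hF.measurePreserving _
  exact (h₃.comp h₂).comp_hasLaw h₁

instance isProbabilityMeasure_gaussianDisorder : IsProbabilityMeasure (gaussianDisorder E) := by
  unfold gaussianDisorder
  infer_instance

theorem IsGaussianPerturbation.hasLaw_pair [IsFiniteMeasure P] {p : unitInterval}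
    {J Jp : Ω → E → ℝ} (h : IsGaussianPerturbation P p J Jp) :
    HasLaw (fun ω e => (J ω e, Jp ω e)) (Measure.pi fun _ => gaussianPair (1 - p)) P := by
  obtain ⟨hJ, J', hJ', hind, hJp⟩ := h
  have := hasLaw_pi_map hJ hJ' hind (measurable_gaussianPair_map (1 - p))
  have e : 2 * (p : ℝ) - (p : ℝ) ^ 2 = 1 - (1 - (p : ℝ)) ^ 2 := by ring
  simpa only [hJp, e, gaussianPair] using this

theorem IsResamplingPerturbation.hasLaw_pair [IsFiniteMeasure P] {p : unitInterval}
    {J Jp : Ω → E → ℝ} (h : IsResamplingPerturbation P p J Jp) :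
    HasLaw (fun ω e => (J ω e, Jp ω e))
      (Measure.pi fun _ => resampledPair (gaussianReal 0 1) (1 - p)) P := by
  obtain ⟨hJ, J', ξ, hJ', hξ, hind, hind', hJp⟩ := h
  have h₁ := hasLaw_pi_map hJ' hξ hind' measurable_id
  simp only [Measure.map_id, id] at h₁
  have hpair : Measurable fun (w : (E → ℝ) × (E → Bool)) e => (w.1 e, w.2 e) := by fun_prop
  have h₂ := hasLaw_pi_map hJ h₁ (hind.comp measurable_id hpair)
    (measurable_fst.prodMk measurable_resample)
  rw [map_resample_eq] at h₂
  simpa only [resample, hJp] using h₂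

theorem hasLaw_snd_of_pair {κ : Measure (ℝ × ℝ)} [IsProbabilityMeasure κ]
    (hκ : κ.map Prod.snd = gaussianReal 0 1) {J Jp : Ω → E → ℝ}
    (h : HasLaw (fun ω e => (J ω e, Jp ω e)) (Measure.pi fun _ => κ) P) :
    HasLaw Jp (gaussianDisorder E) P :=
  (measurePreserving_pi (fun _ : E => κ) (fun _ => gaussianReal 0 1)
    fun _ => ⟨measurable_snd, hκ⟩).comp_hasLaw h

end PairLaw

/-! ### Reduction of the spin correlation to a noise correlation -/

section Main

variable {V : Type*} [Finite V] {G : SimpleGraph V} [Fintype G.edgeSet] {B : Set V} {γ : B → ℤˣ}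
  {Ω : Type*} [MeasurableSpace Ω] {P : Measure Ω} [IsProbabilityMeasure P]

/-- The choices `σ`, `σ'` need not be measurable; integrability comes from almost sure equality with
a product of measurable overlaps. -/
theorem integrable_and_integral_eq_noiseCorr {κ : Measure (ℝ × ℝ)} [IsProbabilityMeasure κ]
    (hκ : κ.map Prod.snd = gaussianReal 0 1) {J Jp : Ω → G.edgeSet → ℝ}
    (hJ : HasLaw J (gaussianDisorder G.edgeSet) P)
    (hlaw : HasLaw (fun ω e => (J ω e, Jp ω e)) (Measure.pi fun _ => κ) P)
    {σ σ' : Ω → V → ℤˣ} (hσ : ∀ᵐ ω ∂P, IsGroundState G γ (J ω) (σ ω))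
    (hσ' : ∀ᵐ ω ∂P, IsGroundState G γ (Jp ω) (σ' ω)) {i j : V} (hij : G.Reachable i j) :
    Integrable (fun ω => ((σ ω i * σ ω j * σ' ω i * σ' ω j : ℤˣ) : ℝ)) P ∧
      ∫ ω, ((σ ω i * σ ω j * σ' ω i * σ' ω j : ℤˣ) : ℝ) ∂P = noiseCorr κ (overlap G γ i j) := by
  have hJp := hasLaw_snd_of_pair hκ hlaw
  have hφ := measurable_overlap (G := G) γ i j
  have huniq := ae_notMem_overlapSet_inter γ hij
  have hms : Measurable fun J : G.edgeSet → ℝ =>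
      J ∉ overlapSet G γ i j 1 ∩ overlapSet G γ i j (-1) :=
    (((measurableSet_overlapSet γ i j 1).inter (measurableSet_overlapSet γ i j (-1))).compl).mem
  have hae : (fun ω => overlap G γ i j (J ω) * overlap G γ i j (Jp ω)) =ᵐ[P]
      fun ω => ((σ ω i * σ ω j * σ' ω i * σ' ω j : ℤˣ) : ℝ) := by
    filter_upwards [hσ, hσ', (hJ.ae_iff hms).2 huniq, (hJp.ae_iff hms).2 huniq]
      with ω h₁ h₂ h₃ h₄
    rw [overlap_eq h₁ h₃, overlap_eq h₂ h₄, mul_assoc (σ ω i * σ ω j)]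
    push_cast
    ring
  have hint : Integrable (fun ω => overlap G γ i j (J ω) * overlap G γ i j (Jp ω)) P :=
    integrable_of_abs_le_one ((hφ.comp_aemeasurable hJ.aemeasurable).mul
      (hφ.comp_aemeasurable hJp.aemeasurable))
      fun ω => abs_mul_le_one (abs_overlap_le_one _ _ _ _) (abs_overlap_le_one _ _ _ _)
  refine ⟨hint.congr hae, ?_⟩
  rw [← integral_congr_ae hae, noiseCorr, ← hlaw.map_eq, integral_map hlaw.aemeasurable]
  refine Measurable.aestronglyMeasurable ?_
  fun_prop

end Main

end

end EdwardsAnderson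

theorem mainTheorem2 {V : Type*} [Fintype V] (G : SimpleGraph V) [Fintype G.edgeSet]
    (hG : G.Connected) (hE : 2 ≤ Fintype.card G.edgeSet)
    (B : Set V) (hB : (G.induce Bᶜ).Connected) (γ : B → ℤˣ)
    {Ω : Type*} [MeasurableSpace Ω] (P : Measure Ω) [IsProbabilityMeasure P]
    (p : unitInterval) (hp0 : 0 < p) (hp1 : p < 1)
    (J Jp : Ω → G.edgeSet → ℝ)
    (hJ : EdwardsAnderson.IsGaussianPerturbation P p J Jp ∨
      EdwardsAnderson.IsResamplingPerturbation P p J Jp)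
    (σ σ' : Ω → V → ℤˣ)
    (hσ : ∀ᵐ ω ∂P, EdwardsAnderson.IsGroundState G γ (J ω) (σ ω))
    (hσ' : ∀ᵐ ω ∂P, EdwardsAnderson.IsGroundState G γ (Jp ω) (σ' ω))
    (i j : V) (hi : i ∉ B) (hj : j ∉ B) :
    Integrable (fun ω => ((σ ω i * σ ω j * σ' ω i * σ' ω j : ℤˣ) : ℝ)) P ∧
      |∫ ω, ((σ ω i * σ ω j * σ' ω i * σ' ω j : ℤˣ) : ℝ) ∂P| ≤
        (1 - (p : ℝ)) ^ (EdwardsAnderson.chaosExponent G B i j).toNat := by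
  have h0 : 0 < 1 - (p : ℝ) := sub_pos.2 (by exact_mod_cast hp1)
  have h1 : 1 - (p : ℝ) < 1 := sub_lt_self _ (by exact_mod_cast hp0)
  have hij : G.Reachable i j := hG.preconnected i j
  have hodd := EdwardsAnderson.exists_sign_overlap_odd (G := G) γ (i := i) (j := j)
  have hm := EdwardsAnderson.measurable_overlap (G := G) γ i j
  have hb := EdwardsAnderson.abs_overlap_le_one (G := G) γ i j
  rcases hJ with h | h
  · obtain ⟨hint, heq⟩ := EdwardsAnderson.integrable_and_integral_eq_noiseCorr
      (EdwardsAnderson.gaussianPair_map_snd (pow_le_one₀ h0.le h1.le)) h.1 h.hasLaw_pair hσ hσ' hij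
    exact ⟨hint, heq ▸ EdwardsAnderson.abs_noiseCorr_gaussianPair_le h0 h1 hm hb hodd⟩
  · have := EdwardsAnderson.isProbabilityMeasure_resampledPair (μ := gaussianReal 0 1) h0.le h1.le
    obtain ⟨hint, heq⟩ := EdwardsAnderson.integrable_and_integral_eq_noiseCorr
      (EdwardsAnderson.resampledPair_map_snd h0.le h1.le) h.1 h.hasLaw_pair hσ hσ' hij
    refine ⟨hint, heq ▸ EdwardsAnderson.abs_noiseCorr_resampledPair_le ?_ h0 h1 hm hb hodd⟩
    rw [gaussianReal_map_neg, neg_zero]
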